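/- Let $n\ge 0$ and $M\ge 1$ be integers. Let $\mathbf Z_1,\dots,\mathbf Z_M\in\mathbb R^n$, let $\boldsymbol D_1,\dots,\boldsymbol D_M\in\mathbb R^{n\times n}$ be arbitrary matrices, let $\boldsymbol\Sigma_{N_1},\dots,\boldsymbol\Sigma_{N_M}\in S_n^{++}(\mathbb R)$ (for instance diagonal with positive entries), where $S_n^{++}(\mathbb R)$ is the set of real symmetric positive definite $n\times n$ matrices, and let $\boldsymbol\mu_0\in\mathbb R^n$, $\boldsymbol\Sigma_0\in S_n^{++}(\mathbb R)$, $\kappa>0$ and $\nu>n-1$. On $\mathbb R^{nM}\times\mathbb R^n\times S_n^{++}(\mathbb R)$ consider $$f(\mathbf C,\boldsymbol\mu,\boldsymbol\Lambda)=\frac12\sum_{i=1}^M(\mathbf Z_i-\boldsymbol D_i\mathbf C_i)^T\boldsymbol\Sigma_{N_i}^{-1}(\mathbf Z_i-\boldsymbol D_i\mathbf C_i)-\frac{\nu-n+M}{2}\log|\boldsymbol\Lambda|+\frac12\sum_{i=1}^M(\mathbf C_i-\boldsymbol\mu)^T\boldsymbol\Lambda(\mathbf C_i-\boldsymbol\mu)+\frac\kappa2(\boldsymbol\mu-\boldsymbol\mu_0)^T\boldsymbol\Lambda(\boldsymbol\mu-\boldsymbol\mu_0)+\frac12\operatorname{trace}(\nu\boldsymbol\Sigma_0\boldsymbol\Lambda).$$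 Let $\boldsymbol\Lambda^0\in S_n^{++}(\mathbb R)$ be arbitrary (for instance $\boldsymbol\Lambda^0=\boldsymbol\Sigma_0^{-1}$) and define, for $l\ge1$, with $\mathbf A_i=(\boldsymbol\Lambda^{l-1})^{-1}\boldsymbol D_i^T\big(\boldsymbol D_i(\boldsymbol\Lambda^{l-1})^{-1}\boldsymbol D_i^T+\boldsymbol\Sigma_{N_i}\big)^{-1}$, $$\boldsymbol\mu^l=\Big(\kappa\,\mathrm{Id}+\sum_{i=1}^M\mathbf A_i\boldsymbol D_i\Big)^{-1}\Big(\sum_{i=1}^M\mathbf A_i\mathbf Z_i+\kappa\boldsymbol\mu_0\Big),\qquad \mathbf C_i^l=\mathbf A_i(\mathbf Z_i-\boldsymbol D_i\boldsymbol\mu^l)+\boldsymbol\mu^l\quad(1\le i\le M),$$ $$\boldsymbol\Lambda^l=\left(\frac{\nu\boldsymbol\Sigma_0+\kappa(\boldsymbol\mu^l-\boldsymbol\mu_0)(\boldsymbol\mu^l-\boldsymbol\mu_0)^T+\sum_{i=1}^M(\mathbf C_i^l-\boldsymbol\mu^l)(\mathbf C_i^l-\boldsymbol\mu^l)^T}{\nu+M-n}\right)^{-1}.$$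 Then: 1. This is alternating minimization of $f$: for every $l\ge1$, $(\mathbf C^l,\boldsymbol\mu^l)$ is the unique minimizer of $f(\cdot,\cdot,\boldsymbol\Lambda^{l-1})$ on $\mathbb R^{nM}\times\mathbb R^n$, and $\boldsymbol\Lambda^l$ is the unique minimizer of $f(\mathbf C^l,\boldsymbol\mu^l,\cdot)$ on $S_n^{++}(\mathbb R)$. 2. The sequence $f(\mathbf C^l,\boldsymbol\mu^l,\boldsymbol\Lambda^l)$, $l\ge1$, is nonincreasing and converges to a real number $v$. 3. The sequence $(\mathbf C^l,\boldsymbol\mu^l,\boldsymbol\Lambda^l)$, $l\ge1$, has at least one accumulation point in $\mathbb R^{nM}\times\mathbb R^n\times\mathbb R^{n\times n}$, and the set of its accumulation points is compact and connected. 4. Every accumulation point $(\mathbf C^*,\boldsymbol\mu^*,\boldsymbol\Lambda^*)$ satisfies $\boldsymbol\Lambda^*\in S_n^{++}(\mathbb R)$; it is a partial optimum of $f$, i.e. $(\mathbf C^*,\boldsymbol\mu^*)$ minimizes $f(\cdot,\cdot,\boldsymbol\Lambda^*)$ on $\mathbb R^{nM}\times\mathbb R^n$ and $\boldsymbol\Lambda^*$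 minimizes $f(\mathbf C^*,\boldsymbol\mu^*,\cdot)$ on $S_n^{++}(\mathbb R)$; it is a stationary point of $f$, i.e. $f$ is differentiable there, with derivative zero (as a function on the open subset $\mathbb R^{nM}\times\mathbb R^n\times S_n^{++}(\mathbb R)$ of the space of triples with symmetric $\boldsymbol\Lambda$); and $f(\mathbf C^*,\boldsymbol\mu^*,\boldsymbol\Lambda^*)=v$. -/

import Mathlib

open Filter Topology Matrix

namespace HBE

/-- Inputs of the algorithm: `M` observed patches `Z i` in `ℝⁿ`, degradation matrices `D i`, noise
covariances `SN i` (fixed, so not depending on the unknown patches), prior mean `mu0`, prior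
covariance `S0`, scale `kappa` and degrees of freedom `nu` of the Normal-Wishart hyperprior. -/
structure Data (n M : ℕ) where
  Z : Fin M → Fin n → ℝ
  D : Fin M → Matrix (Fin n) (Fin n) ℝ
  SN : Fin M → Matrix (Fin n) (Fin n) ℝ
  mu0 : Fin n → ℝ
  S0 : Matrix (Fin n) (Fin n) ℝ
  kappa : ℝ
  nu : ℝ

/-- Triples `(C, μ, Λ)`. The energy is considered on the triples whose `Λ` is positive definite
(see `domain`). -/
abbrev State (n M : ℕ) : Type :=
  (Fin M → Fin n → ℝ) × (Fin n → ℝ) × Matrix (Fin n) (Fin n) ℝ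

/-- The set of real symmetric positive definite matrices of size `n`
(for real matrices `Matrix.PosDef` contains symmetry). -/
def posDefSet (n : ℕ) : Set (Matrix (Fin n) (Fin n) ℝ) := {L | L.PosDef}

/-- The domain of the energy: patches and mean are free, the precision matrix is symmetric
positive definite. -/
def domain (n M : ℕ) : Set (State n M) := {x | x.2.2 ∈ posDefSet n}

section

variable {n M : ℕ}

/-- The joint MAP energy, i.e. the negative logarithm of the joint posterior density up to an
additive constant. -/
noncomputable def energy (P : Data n M) (C : Fin M → Fin n → ℝ) (mu : Fin n → ℝ)
    (L : Matrix (Fin n) (Fin n) ℝ) : ℝ :=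
  (1 / 2) * ∑ i, (P.Z i - P.D i *ᵥ C i) ⬝ᵥ ((P.SN i)⁻¹ *ᵥ (P.Z i - P.D i *ᵥ C i))
    - ((P.nu - n + M) / 2) * Real.log L.det
    + (1 / 2) * ∑ i, (C i - mu) ⬝ᵥ (L *ᵥ (C i - mu))
    + (P.kappa / 2) * ((mu - P.mu0) ⬝ᵥ (L *ᵥ (mu - P.mu0)))
    + (1 / 2) * (P.nu • P.S0 * L).trace

/-- The energy as a function of the triple. -/
noncomputable def f (P : Data n M) (x : State n M) : ℝ := energy P x.1 x.2.1 x.2.2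

/-- `A_i = Λ⁻¹ D_iᵀ (D_i Λ⁻¹ D_iᵀ + Σ_{N_i})⁻¹`. -/
noncomputable def gain (P : Data n M) (L : Matrix (Fin n) (Fin n) ℝ) (i : Fin M) :
    Matrix (Fin n) (Fin n) ℝ :=
  L⁻¹ * (P.D i)ᵀ * (P.D i * L⁻¹ * (P.D i)ᵀ + P.SN i)⁻¹

/-- Update of the mean:
`(κ Id + ∑ A_i D_i)⁻¹ (∑ A_i Z_i + κ μ₀)`. -/
noncomputable def updateMu (P : Data n M) (L : Matrix (Fin n) (Fin n) ℝ) : Fin n → ℝ :=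
  (P.kappa • (1 : Matrix (Fin n) (Fin n) ℝ) + ∑ i, gain P L i * P.D i)⁻¹ *ᵥ
    (∑ i, gain P L i *ᵥ P.Z i + P.kappa • P.mu0)

/-- Update of the patches: `A_i (Z_i - D_i μ̂) + μ̂`. -/
noncomputable def updateC (P : Data n M) (L : Matrix (Fin n) (Fin n) ℝ) : Fin M → Fin n → ℝ :=
  fun i => gain P L i *ᵥ (P.Z i - P.D i *ᵥ updateMu P L) + updateMu P L

/-- Update of the precision matrix: the inverse of
`(ν Σ₀ + κ (μ - μ₀)(μ - μ₀)ᵀ + ∑ (C_i - μ)(C_i - μ)ᵀ) / (ν + M - n)`. -/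
noncomputable def updateL (P : Data n M) (C : Fin M → Fin n → ℝ) (mu : Fin n → ℝ) :
    Matrix (Fin n) (Fin n) ℝ :=
  ((P.nu + M - n)⁻¹ •
    (P.nu • P.S0 + P.kappa • vecMulVec (mu - P.mu0) (mu - P.mu0)
      + ∑ i, vecMulVec (C i - mu) (C i - mu)))⁻¹

/-- The precision matrices `Λ⁰, Λ¹, Λ², …` produced by the algorithm started at `Λ⁰ = L0`. -/
noncomputable def precision (P : Data n M) (L0 : Matrix (Fin n) (Fin n) ℝ) :
    ℕ → Matrix (Fin n) (Fin n) ℝ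
  | 0 => L0
  | l + 1 => updateL P (updateC P (precision P L0 l)) (updateMu P (precision P L0 l))

/-- The iterates of the algorithm. The algorithm numbers them from `1` on (there are no
`C⁰`, `μ⁰`): `iter P L0 l` is `(C^{l+1}, μ^{l+1}, Λ^{l+1})`, where `C^{l+1}` and `μ^{l+1}` are
computed from `Λ^l`, and then `Λ^{l+1}` from `C^{l+1}` and `μ^{l+1}`. -/
noncomputable def iter (P : Data n M) (L0 : Matrix (Fin n) (Fin n) ℝ) (l : ℕ) : State n M :=
  (updateC P (precision P L0 l), updateMu P (precision P L0 l), precision P L0 (l + 1))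

/-- `a` is the unique minimizer of `g` on `s`. -/
def IsArgmin {α : Type*} (g : α → ℝ) (s : Set α) (a : α) : Prop :=
  a ∈ s ∧ ∀ b ∈ s, b ≠ a → g a < g b

/-- Accumulation points of a sequence of triples (limits of subsequences), in the whole space of
triples, so that limits with a singular `Λ` are not excluded beforehand. -/
def accPoints (x : ℕ → State n M) : Set (State n M) := {y | MapClusterPt y atTop x}

/-- Partial optima of the energy: `(C, μ)` is a minimizer of the energy for the given `Λ`, and `Λ`
is a minimizer, among positive definite matrices, for the given `(C, μ)`. -/
def IsPartialOptimum (P : Data n M) (x : State n M) : Prop :=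
  x ∈ domain n M ∧
  IsMinOn (fun p : (Fin M → Fin n → ℝ) × (Fin n → ℝ) => energy P p.1 p.2 x.2.2) Set.univ
    (x.1, x.2.1) ∧
  IsMinOn (fun L => energy P x.1 x.2.1 L) (posDefSet n) x.2.2

/-- Stationary points of the energy: points of the domain at which it is differentiable with
derivative zero. The domain is an open subset of the linear space of triples with symmetric `Λ`,
so the derivative is the one along the domain. -/
def IsStationary (P : Data n M) (x : State n M) : Prop :=
  x ∈ domain n M ∧
  HasFDerivWithinAt (f P) (0 : State n M →L[ℝ] ℝ) (domain n M) x

end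

end HBE

/-! Both half-steps are exact and strict. For fixed `Λ` the energy is its value at `(updateC,
updateMu)` plus a positive definite quadratic form in the displacement (`energy_add`). For fixed
`(C, μ)` it is, up to a constant and a positive factor, `tr (B Λ) - log det Λ`, which `log t ≤ t -
1` on eigenvalues minimizes only at `B⁻¹`. Hence the energy decreases. The energy also dominates a
function of `Λ` alone whose sublevel sets are relatively compact among positive definite matrices.
So the precisions stay in a compact set, and the iterates, being continuous images of them under
`step`, do too. If `x` is an accumulation point, so is its image under `step`; both have energy `v`,
and uniqueness of the minimizers makes `x` a fixed point, hence a partial optimum. The derivative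
then vanishes on each block, hence along the domain. Finally, consecutive iterates have the same
limits, so the sequence cannot cross infinitely often between two separated pieces of its cluster
set. -/

namespace Matrix

/-! ### Quadratic forms and the log-determinant inequality -/

variable {m : Type*} [Fintype m]

theorem PosDef.dotProduct_pos {A : Matrix m m ℝ} (hA : A.PosDef) {x : m → ℝ} (hx : x ≠ 0) :
    0 < x ⬝ᵥ (A *ᵥ x) := by
  simpa using hA.dotProduct_mulVec_pos hx

theorem PosSemidef.dotProduct_nonneg {A : Matrix m m ℝ} (hA : A.PosSemidef) (x : m → ℝ) :
    0 ≤ x ⬝ᵥ (A *ᵥ x) := by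
  simpa using hA.dotProduct_mulVec_nonneg x

theorem IsHermitian.dotProduct_mulVec_comm {A : Matrix m m ℝ} (hA : A.IsHermitian) (x y : m → ℝ) :
    x ⬝ᵥ (A *ᵥ y) = y ⬝ᵥ (A *ᵥ x) := by
  have h : Aᵀ = A := isHermitian_iff_isSymm.mp hA
  rw [dotProduct_mulVec, ← mulVec_transpose, h, dotProduct_comm]

theorem IsHermitian.dotProduct_mulVec_add {A : Matrix m m ℝ} (hA : A.IsHermitian) (x y : m → ℝ) :
    (x + y) ⬝ᵥ (A *ᵥ (x + y)) = x ⬝ᵥ (A *ᵥ x) + 2 * (y ⬝ᵥ (A *ᵥ x)) + y ⬝ᵥ (A *ᵥ y) := by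
  rw [mulVec_add, add_dotProduct, dotProduct_add, dotProduct_add, hA.dotProduct_mulVec_comm x y]
  ring

theorem transpose_mulVec_dotProduct (A : Matrix m m ℝ) (x y : m → ℝ) :
    x ⬝ᵥ (Aᵀ *ᵥ y) = (A *ᵥ x) ⬝ᵥ y := by
  rw [mulVec_transpose, dotProduct_comm, ← dotProduct_mulVec, dotProduct_comm]

theorem PosSemidef.mul_mul_transpose {A : Matrix m m ℝ} (hA : A.PosSemidef) (B : Matrix m m ℝ) :
    (B * A * Bᵀ).PosSemidef := by
  simpa [conjTranspose_eq_transpose_of_trivial] using hA.mul_mul_conjTranspose_same B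

theorem PosSemidef.transpose_mul_mul {A : Matrix m m ℝ} (hA : A.PosSemidef) (B : Matrix m m ℝ) :
    (Bᵀ * A * B).PosSemidef := by
  simpa [conjTranspose_eq_transpose_of_trivial] using hA.conjTranspose_mul_mul_same B

variable [DecidableEq m]

theorem PosDef.isUnit_det {A : Matrix m m ℝ} (hA : A.PosDef) : IsUnit A.det :=
  hA.det_pos.ne'.isUnit

theorem PosDef.exists_transpose_mul_self {B : Matrix m m ℝ} (hB : B.PosDef) :
    ∃ X : Matrix m m ℝ, IsUnit X.det ∧ B = Xᵀ * X := by
  open scoped MatrixOrder in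
  obtain ⟨X, hX⟩ := CStarAlgebra.nonneg_iff_eq_star_mul_self.mp hB.posSemidef.nonneg
  rw [star_eq_conjTranspose, conjTranspose_eq_transpose_of_trivial] at hX
  refine ⟨X, ?_, hX⟩
  have h := hB.det_pos.ne'
  rw [hX, det_mul, det_transpose] at h
  exact (left_ne_zero_of_mul h).isUnit

theorem PosDef.mul_mul_transpose_of_isUnit {A X : Matrix m m ℝ} (hA : A.PosDef)
    (hX : IsUnit X.det) : (X * A * Xᵀ).PosDef := by
  rw [← conjTranspose_eq_transpose_of_trivial]
  exact (IsUnit.posDef_star_right_conjugate_iff ((isUnit_iff_isUnit_det X).mpr hX)).mpr hA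

/-- Sum `log t ≤ t - 1` over the eigenvalues. Equality forces every eigenvalue to be `1`, and then
the spectral theorem gives `K = 1`. -/
theorem PosDef.log_det_le {K : Matrix m m ℝ} (hK : K.PosDef) :
    Real.log K.det ≤ K.trace - Fintype.card m ∧
      (K ≠ 1 → Real.log K.det < K.trace - Fintype.card m) := by
  have hpos := hK.eigenvalues_pos
  have hdet : Real.log K.det = ∑ i, Real.log (hK.1.eigenvalues i) := by
    rw [hK.1.det_eq_prod_eigenvalues]
    simp only [RCLike.ofReal_real_eq_id, id_eq]
    exact Real.log_prod fun i _ => (hpos i).ne'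
  have htr : K.trace - Fintype.card m = ∑ i, (hK.1.eigenvalues i - 1) := by
    rw [hK.1.trace_eq_sum_eigenvalues]
    simp
  rw [hdet, htr]
  refine ⟨Finset.sum_le_sum fun i _ => Real.log_le_sub_one_of_pos (hpos i), fun hne => ?_⟩
  refine Finset.sum_lt_sum (fun i _ => Real.log_le_sub_one_of_pos (hpos i)) ?_
  by_contra! h
  refine hne ?_
  have h1 : ∀ i, hK.1.eigenvalues i = 1 := fun i => by
    by_contra hi
    exact absurd (Real.log_lt_sub_one_of_pos (hpos i) hi) (not_lt.mpr (h i (Finset.mem_univ i)))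
  rw [hK.1.spectral_theorem]
  have : (RCLike.ofReal ∘ hK.1.eigenvalues : m → ℝ) = 1 := by
    ext i
    simp [h1 i]
  rw [this]
  simp

/-- For positive definite `B`, the function `A ↦ tr (B A) - log det A` is minimal exactly at
`A = B⁻¹`. -/
theorem PosDef.log_det_add_log_det_le {A B : Matrix m m ℝ} (hA : A.PosDef) (hB : B.PosDef) :
    Real.log A.det + Real.log B.det ≤ (B * A).trace - Fintype.card m ∧
      (A ≠ B⁻¹ → Real.log A.det + Real.log B.det < (B * A).trace - Fintype.card m) := by
  -- With `B = Xᵀ X`, the congruent matrix `X A Xᵀ` has trace `tr (B A)` and determinant `det A *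
  -- det B`, which reduces the claim to `B = 1`.
  obtain ⟨X, hX, rfl⟩ := hB.exists_transpose_mul_self
  have hK := (hA.mul_mul_transpose_of_isUnit hX).log_det_le
  have htr : (X * A * Xᵀ).trace = (Xᵀ * X * A).trace := by
    rw [trace_mul_comm, Matrix.mul_assoc]
  have hdet : Real.log (X * A * Xᵀ).det = Real.log A.det + Real.log (Xᵀ * X).det := by
    rw [← Real.log_mul hA.det_pos.ne' hB.det_pos.ne']
    congr 1
    simp only [det_mul, det_transpose]
    ring
  rw [htr, hdet] at hK
  refine ⟨hK.1, fun hne => hK.2 fun h => hne ?_⟩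
  have hXt : IsUnit Xᵀ.det := by rwa [det_transpose]
  rw [Matrix.mul_inv_rev]
  calc A = X⁻¹ * (X * A * Xᵀ) * Xᵀ⁻¹ := by
        rw [Matrix.mul_assoc X⁻¹, Matrix.mul_nonsing_inv_cancel_right _ _ hXt,
          Matrix.nonsing_inv_mul_cancel_left _ _ hX]
    _ = X⁻¹ * Xᵀ⁻¹ := by rw [h, Matrix.mul_one]

end Matrix

/-! ### Exact minimization in each block -/

namespace HBE

variable {n M : ℕ} {P : Data n M} {L : Matrix (Fin n) (Fin n) ℝ}

/-- The covariance `D_i Λ⁻¹ D_iᵀ + Σ_{N_i}` of the observation `Z_i` given `μ` and `Λ`. -/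
noncomputable def obsCov (P : Data n M) (L : Matrix (Fin n) (Fin n) ℝ) (i : Fin M) :
    Matrix (Fin n) (Fin n) ℝ :=
  P.D i * L⁻¹ * (P.D i)ᵀ + P.SN i

theorem gain_eq (P : Data n M) (L : Matrix (Fin n) (Fin n) ℝ) (i : Fin M) :
    gain P L i = L⁻¹ * (P.D i)ᵀ * (obsCov P L i)⁻¹ := rfl

theorem obsCov_posDef (hSN : ∀ i, (P.SN i).PosDef) (hL : L.PosDef) (i : Fin M) :
    (obsCov P L i).PosDef :=
  PosDef.posSemidef_add (hL.inv.posSemidef.mul_mul_transpose (P.D i)) (hSN i)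

theorem mul_gain (hL : L.PosDef) (i : Fin M) :
    L * gain P L i = (P.D i)ᵀ * (obsCov P L i)⁻¹ := by
  rw [gain_eq, Matrix.mul_assoc L⁻¹, Matrix.mul_nonsing_inv_cancel_left _ _ hL.isUnit_det]

/-- The matrix need not be symmetric, but left multiplication by `L` turns it into `κ L` plus
positive semidefinite terms. -/
theorem isUnit_det_meanSystem (hSN : ∀ i, (P.SN i).PosDef) (hkappa : 0 < P.kappa) (hL : L.PosDef) :
    IsUnit (P.kappa • (1 : Matrix (Fin n) (Fin n) ℝ) + ∑ i, gain P L i * P.D i).det := by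
  have h : (P.kappa • L + ∑ i, (P.D i)ᵀ * (obsCov P L i)⁻¹ * P.D i).PosDef :=
    (hL.smul hkappa).add_posSemidef
      (posSemidef_sum _ fun i _ => (obsCov_posDef hSN hL i).inv.posSemidef.transpose_mul_mul _)
  have h2 : L * (P.kappa • (1 : Matrix (Fin n) (Fin n) ℝ) + ∑ i, gain P L i * P.D i)
      = P.kappa • L + ∑ i, (P.D i)ᵀ * (obsCov P L i)⁻¹ * P.D i := by
    rw [Matrix.mul_add, Matrix.mul_smul, Matrix.mul_one, Matrix.mul_sum]
    congr 1
    refine Finset.sum_congr rfl fun i _ => ?_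
    rw [← Matrix.mul_assoc, mul_gain hL]
  have h3 := h.isUnit_det
  rw [← h2, det_mul] at h3
  exact isUnit_of_mul_isUnit_right h3

theorem updateC_sub_updateMu (P : Data n M) (L : Matrix (Fin n) (Fin n) ℝ) (i : Fin M) :
    updateC P L i - updateMu P L = gain P L i *ᵥ (P.Z i - P.D i *ᵥ updateMu P L) := by
  simp [updateC]

/-- Stationarity of the energy in the mean. -/
theorem sum_updateC_sub_updateMu (hSN : ∀ i, (P.SN i).PosDef) (hkappa : 0 < P.kappa)
    (hL : L.PosDef) :
    ∑ i, (updateC P L i - updateMu P L) = P.kappa • (updateMu P L - P.mu0) := by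
  have h : (P.kappa • (1 : Matrix (Fin n) (Fin n) ℝ) + ∑ i, gain P L i * P.D i) *ᵥ updateMu P L
      = ∑ i, gain P L i *ᵥ P.Z i + P.kappa • P.mu0 := by
    rw [updateMu, mulVec_mulVec, Matrix.mul_nonsing_inv _ (isUnit_det_meanSystem hSN hkappa hL),
      one_mulVec]
  rw [add_mulVec, smul_mulVec, one_mulVec, sum_mulVec] at h
  simp only [updateC_sub_updateMu, mulVec_sub, mulVec_mulVec, Finset.sum_sub_distrib, smul_sub]
  rw [sub_eq_sub_iff_add_eq_add, ← h, add_comm]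

/-- Stationarity of the energy in the patch `C_i`. -/
theorem mulVec_updateC_sub_updateMu (hSN : ∀ i, (P.SN i).PosDef) (hL : L.PosDef) (i : Fin M) :
    (P.D i)ᵀ *ᵥ ((P.SN i)⁻¹ *ᵥ (P.Z i - P.D i *ᵥ updateC P L i))
      = L *ᵥ (updateC P L i - updateMu P L) := by
  rw [updateC_sub_updateMu, mulVec_mulVec (M := L), mul_gain hL, ← mulVec_mulVec]
  congr 1
  set r := P.Z i - P.D i *ᵥ updateMu P L with hr
  -- The residual after the update is `r - (S - Σ_N) S⁻¹ r = Σ_N S⁻¹ r`, with `S` the observation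
  -- covariance.
  have h : P.Z i - P.D i *ᵥ updateC P L i = P.SN i *ᵥ ((obsCov P L i)⁻¹ *ᵥ r) := by
    have h1 : P.SN i = obsCov P L i - P.D i * L⁻¹ * (P.D i)ᵀ := by simp [obsCov]
    rw [h1, sub_mulVec, mulVec_mulVec, Matrix.mul_nonsing_inv _ (obsCov_posDef hSN hL i).isUnit_det,
      one_mulVec, updateC, mulVec_add, ← hr, gain_eq, mulVec_mulVec, mulVec_mulVec, hr]
    simp only [Matrix.mul_assoc]
    abel
  rw [h, mulVec_mulVec, Matrix.nonsing_inv_mul _ (hSN i).isUnit_det, one_mulVec]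

/-- The energy is quadratic in `(C, μ)`, and the two stationarity identities cancel the terms linear
in `(h, k)`. -/
theorem energy_add (hSN : ∀ i, (P.SN i).PosDef) (hkappa : 0 < P.kappa) (hL : L.PosDef)
    (h : Fin M → Fin n → ℝ) (k : Fin n → ℝ) :
    energy P (updateC P L + h) (updateMu P L + k) L
      = energy P (updateC P L) (updateMu P L) L
        + ((1 / 2) * ∑ i, (P.D i *ᵥ h i) ⬝ᵥ ((P.SN i)⁻¹ *ᵥ (P.D i *ᵥ h i))
          + (1 / 2) * ∑ i, (h i - k) ⬝ᵥ (L *ᵥ (h i - k)) + (P.kappa / 2) * (k ⬝ᵥ (L *ᵥ k))) := by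
  have hs := sum_updateC_sub_updateMu hSN hkappa hL
  have hc := mulVec_updateC_sub_updateMu hSN hL
  set C := updateC P L
  set mu := updateMu P L
  have e1 : ∀ i, (P.Z i - P.D i *ᵥ (C + h) i) ⬝ᵥ ((P.SN i)⁻¹ *ᵥ (P.Z i - P.D i *ᵥ (C + h) i))
      = (P.Z i - P.D i *ᵥ C i) ⬝ᵥ ((P.SN i)⁻¹ *ᵥ (P.Z i - P.D i *ᵥ C i))
        - 2 * (h i ⬝ᵥ (L *ᵥ (C i - mu)))
        + (P.D i *ᵥ h i) ⬝ᵥ ((P.SN i)⁻¹ *ᵥ (P.D i *ᵥ h i)) := fun i => by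
    have : P.Z i - P.D i *ᵥ (C + h) i = (P.Z i - P.D i *ᵥ C i) + -(P.D i *ᵥ h i) := by
      rw [Pi.add_apply, mulVec_add]
      abel
    rw [this, (hSN i).inv.1.dotProduct_mulVec_add, ← hc i, transpose_mulVec_dotProduct]
    simp only [neg_dotProduct, mulVec_neg, dotProduct_neg]
    ring
  have e2 : ∀ i, ((C + h) i - (mu + k)) ⬝ᵥ (L *ᵥ ((C + h) i - (mu + k)))
      = (C i - mu) ⬝ᵥ (L *ᵥ (C i - mu))
        + 2 * (h i ⬝ᵥ (L *ᵥ (C i - mu)) - k ⬝ᵥ (L *ᵥ (C i - mu)))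
        + (h i - k) ⬝ᵥ (L *ᵥ (h i - k)) := fun i => by
    have : (C + h) i - (mu + k) = (C i - mu) + (h i - k) := by
      rw [Pi.add_apply]
      abel
    rw [this, hL.1.dotProduct_mulVec_add, sub_dotProduct (h i)]
  have e3 : mu + k - P.mu0 = (mu - P.mu0) + k := by abel
  have e4 : ∑ i, k ⬝ᵥ (L *ᵥ (C i - mu)) = P.kappa * (k ⬝ᵥ (L *ᵥ (mu - P.mu0))) := by
    rw [← dotProduct_sum, ← mulVec_sum, hs, mulVec_smul, dotProduct_smul, smul_eq_mul]
  simp only [energy, e1, e2, e3, hL.1.dotProduct_mulVec_add, Finset.sum_add_distrib,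
    Finset.sum_sub_distrib, ← Finset.mul_sum, e4]
  ring

theorem isArgmin_update (hSN : ∀ i, (P.SN i).PosDef) (hkappa : 0 < P.kappa) (hL : L.PosDef) :
    IsArgmin (fun p : (Fin M → Fin n → ℝ) × (Fin n → ℝ) => energy P p.1 p.2 L) Set.univ
      (updateC P L, updateMu P L) := by
  refine ⟨Set.mem_univ _, fun ⟨C, mu⟩ _ hne => ?_⟩
  have hE := energy_add hSN hkappa hL (C - updateC P L) (mu - updateMu P L)
  rw [add_sub_cancel, add_sub_cancel] at hE
  change energy P (updateC P L) (updateMu P L) L < energy P C mu L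
  rw [hE, lt_add_iff_pos_right]
  set h := C - updateC P L with hh
  set k := mu - updateMu P L with hk
  have h1 : 0 ≤ ∑ i, (P.D i *ᵥ h i) ⬝ᵥ ((P.SN i)⁻¹ *ᵥ (P.D i *ᵥ h i)) :=
    Finset.sum_nonneg fun i _ => (hSN i).inv.posSemidef.dotProduct_nonneg _
  have h2 : ∀ i ∈ Finset.univ, 0 ≤ (h i - k) ⬝ᵥ (L *ᵥ (h i - k)) := fun i _ =>
    hL.posSemidef.dotProduct_nonneg _
  -- The `D i` may be singular, so strictness comes from the other terms: the prior term if `k ≠ 0`,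
  -- otherwise some `h i - k = h i ≠ 0`.
  by_cases hk0 : k = 0
  · have hh0 : h ≠ 0 := fun hh0 =>
      hne (Prod.ext (sub_eq_zero.mp (hh ▸ hh0)) (sub_eq_zero.mp (hk ▸ hk0)))
    obtain ⟨i, hi⟩ := Function.ne_iff.mp hh0
    have h3 : 0 < ∑ i, (h i - k) ⬝ᵥ (L *ᵥ (h i - k)) :=
      Finset.sum_pos' h2 ⟨i, Finset.mem_univ i, hL.dotProduct_pos (by simpa [hk0] using hi)⟩
    have h4 : 0 ≤ P.kappa / 2 * (k ⬝ᵥ (L *ᵥ k)) := by simp [hk0]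
    linarith
  · have h3 : 0 ≤ ∑ i, (h i - k) ⬝ᵥ (L *ᵥ (h i - k)) := Finset.sum_nonneg h2
    have h4 : 0 < P.kappa / 2 * (k ⬝ᵥ (L *ᵥ k)) :=
      mul_pos (half_pos hkappa) (hL.dotProduct_pos hk0)
    linarith

/-- The matrix `ν Σ₀ + κ (μ - μ₀)(μ - μ₀)ᵀ + ∑ (C_i - μ)(C_i - μ)ᵀ`. -/
noncomputable def scatter (P : Data n M) (C : Fin M → Fin n → ℝ) (mu : Fin n → ℝ) :
    Matrix (Fin n) (Fin n) ℝ :=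
  P.nu • P.S0 + P.kappa • vecMulVec (mu - P.mu0) (mu - P.mu0)
    + ∑ i, vecMulVec (C i - mu) (C i - mu)

theorem updateL_eq (P : Data n M) (C : Fin M → Fin n → ℝ) (mu : Fin n → ℝ) :
    updateL P C mu = ((P.nu + M - n)⁻¹ • scatter P C mu)⁻¹ := rfl

theorem smul_S0_posDef (hS0 : P.S0.PosDef) (hnu : (n : ℝ) - 1 < P.nu) :
    (P.nu • P.S0).PosDef := by
  -- For `n = 0` the bound only gives `ν > -1`, but all empty matrices coincide.
  rcases Nat.eq_zero_or_pos n with rfl | hn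
  · exact (Subsingleton.elim P.S0 (P.nu • P.S0)) ▸ hS0
  · have : (1 : ℝ) ≤ n := by exact_mod_cast hn
    exact hS0.smul (by linarith)

theorem vecMulVec_self_posSemidef (v : Fin n → ℝ) : (vecMulVec v v).PosSemidef := by
  simpa using posSemidef_vecMulVec_self_star v

theorem scatter_posDef (hS0 : P.S0.PosDef) (hnu : (n : ℝ) - 1 < P.nu) (hkappa : 0 < P.kappa)
    (C : Fin M → Fin n → ℝ) (mu : Fin n → ℝ) : (scatter P C mu).PosDef :=
  ((smul_S0_posDef hS0 hnu).add_posSemidef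
    ((vecMulVec_self_posSemidef _).smul hkappa.le)).add_posSemidef
      (posSemidef_sum _ fun _ _ => vecMulVec_self_posSemidef _)

theorem weight_pos (hM : 1 ≤ M) (hnu : (n : ℝ) - 1 < P.nu) : 0 < P.nu + M - n := by
  have : (1 : ℝ) ≤ M := by exact_mod_cast hM
  linarith

theorem updateL_posDef (hM : 1 ≤ M) (hS0 : P.S0.PosDef) (hnu : (n : ℝ) - 1 < P.nu)
    (hkappa : 0 < P.kappa) (C : Fin M → Fin n → ℝ) (mu : Fin n → ℝ) : (updateL P C mu).PosDef :=
  ((scatter_posDef hS0 hnu hkappa C mu).smul (inv_pos.mpr (weight_pos hM hnu))).inv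

theorem trace_vecMulVec_mul (v : Fin n → ℝ) (L : Matrix (Fin n) (Fin n) ℝ) :
    (vecMulVec v v * L).trace = v ⬝ᵥ (L *ᵥ v) := by
  rw [trace_mul_comm, mul_vecMulVec, trace_vecMulVec, dotProduct_comm]

/-- Since `vᵀ L v = tr (v vᵀ L)`, the dependence on `L` takes the form treated by
`PosDef.log_det_add_log_det_le`. -/
theorem energy_eq_scatter (P : Data n M) (C : Fin M → Fin n → ℝ) (mu : Fin n → ℝ)
    (L : Matrix (Fin n) (Fin n) ℝ) :
    energy P C mu L
      = (1 / 2) * ∑ i, (P.Z i - P.D i *ᵥ C i) ⬝ᵥ ((P.SN i)⁻¹ *ᵥ (P.Z i - P.D i *ᵥ C i))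
        - ((P.nu + M - n) / 2) * Real.log L.det + (1 / 2) * (scatter P C mu * L).trace := by
  simp only [energy, scatter, Matrix.add_mul, trace_add, Matrix.sum_mul, trace_sum, smul_mul,
    trace_smul, trace_vecMulVec_mul, smul_eq_mul]
  ring

theorem isArgmin_updateL (hM : 1 ≤ M) (hS0 : P.S0.PosDef) (hnu : (n : ℝ) - 1 < P.nu)
    (hkappa : 0 < P.kappa) (C : Fin M → Fin n → ℝ) (mu : Fin n → ℝ) :
    IsArgmin (fun L => energy P C mu L) (posDefSet n) (updateL P C mu) := by
  have ha := weight_pos hM hnu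
  have hU := updateL_posDef hM hS0 hnu hkappa C mu
  have hB := (scatter_posDef hS0 hnu hkappa C mu).smul (inv_pos.mpr ha)
  refine ⟨hU, fun L hL hne => ?_⟩
  change energy P C mu (updateL P C mu) < energy P C mu L
  have key : ∀ L : Matrix (Fin n) (Fin n) ℝ, (1 / 2) * (scatter P C mu * L).trace
      = (P.nu + M - n) / 2 * (((P.nu + M - n)⁻¹ • scatter P C mu) * L).trace := fun L => by
    rw [smul_mul, trace_smul, smul_eq_mul]
    field_simp
  rw [energy_eq_scatter, energy_eq_scatter, key, key]
  rw [updateL_eq] at hne ⊢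
  set B := (P.nu + M - n)⁻¹ • scatter P C mu
  have h1 := (PosDef.log_det_add_log_det_le hL hB).2 hne
  have h2 : (B * B⁻¹).trace = Fintype.card (Fin n) := by
    rw [Matrix.mul_nonsing_inv _ hB.isUnit_det, trace_one]
  have h3 : Real.log B⁻¹.det = - Real.log B.det := by
    rw [det_nonsing_inv, Ring.inverse_eq_inv', Real.log_inv]
  rw [h2, h3]
  nlinarith [mul_lt_mul_of_pos_left h1 (half_pos ha)]

end HBE

/-! ### Connectedness of cluster sets -/

/-- If the consecutive terms of a sequence in a compact set have the same limits along every
filter along which it converges, then the set of its cluster points is preconnected. -/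
theorem isPreconnected_setOf_mapClusterPt {X : Type*} [TopologicalSpace X] [T2Space X] {K : Set X}
    (hK : IsCompact K) {x : ℕ → X} (hx : ∀ᶠ l in atTop, x l ∈ K)
    (hstep : ∀ (F : Filter ℕ) (y : X), F.NeBot → F ≤ atTop → Tendsto x F (𝓝 y) →
      Tendsto (fun l => x (l + 1)) F (𝓝 y)) :
    IsPreconnected {y | MapClusterPt y atTop x} := by
  have hclosed : IsClosed {y | MapClusterPt y atTop x} := isClosed_setOfPred_clusterPt
  have hsub : {y | MapClusterPt y atTop x} ⊆ K := fun y hy => by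
    exact isClosed_iff_clusterPt.mp hK.isClosed y (hy.clusterPt.mono (le_principal_iff.mpr hx))
  have hcpt : IsCompact {y | MapClusterPt y atTop x} := hK.of_isClosed_subset hclosed hsub
  have hcl : ∀ (F : Filter ℕ), F.NeBot → F ≤ atTop → ∃ y ∈ K, ∃ G : Filter ℕ, G.NeBot ∧ G ≤ F ∧
      Tendsto x G (𝓝 y) := fun F _ hle => by
    obtain ⟨y, hyK, hy⟩ := hK.exists_mapClusterPt (le_principal_iff.mpr (hle hx) : map x F ≤ 𝓟 K)
    refine ⟨y, hyK, F ⊓ comap x (𝓝 y), ?_, inf_le_left, tendsto_comap.mono_left inf_le_right⟩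
    rw [← map_neBot_iff x, Filter.push_pull, inf_comm]
    exact hy
  rw [isPreconnected_iff_subset_of_fully_disjoint_closed hclosed]
  intro u v hu hv huv hdisj
  by_contra! hne
  obtain ⟨⟨b, hb, hbu⟩, ⟨a, ha, hav⟩⟩ := And.imp Set.not_subset.mp Set.not_subset.mp hne
  have hau : a ∈ u := (huv ha).resolve_right hav
  have hbv : b ∈ v := (huv hb).resolve_left hbu
  obtain ⟨U, V, hU, hV, hsU, hsV, hUV⟩ := SeparatedNhds.of_isCompact_isCompact
    (hcpt.inter_right hu) (hcpt.inter_right hv)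
    (hdisj.mono Set.inter_subset_right Set.inter_subset_right)
  have hcover : ∀ y, MapClusterPt y atTop x → y ∈ U ∪ V := fun y hy =>
    (huv hy).imp (fun h => hsU ⟨hy, h⟩) (fun h => hsV ⟨hy, h⟩)
  have hev : ∀ᶠ l in atTop, x l ∈ U ∪ V := by
    by_contra hcon
    have hF : (atTop ⊓ 𝓟 {l | x l ∉ U ∪ V}).NeBot := frequently_mem_iff_neBot.mp (not_eventually.mp hcon)
    obtain ⟨y, -, G, hG, hGF, hGy⟩ := hcl _ hF inf_le_left
    have hy : MapClusterPt y atTop x := hGy.mapClusterPt.mono (hGF.trans inf_le_left)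
    have h1 := hGy ((hU.union hV).mem_nhds (hcover y hy))
    have h2 : ∀ᶠ l in G, x l ∉ U ∪ V := hGF.trans inf_le_right (mem_principal_self _)
    obtain ⟨l, hl1, hl2⟩ := (h2.and h1).exists
    exact hl1 hl2
  have hfU : ∃ᶠ l in atTop, x l ∈ U := ha.frequently (hU.mem_nhds (hsU ⟨ha, hau⟩))
  have hfV : ∃ᶠ l in atTop, x l ∈ V := hb.frequently (hV.mem_nhds (hsV ⟨hb, hbv⟩))
  -- Otherwise, once in `U` late enough, the sequence would stay there and never return to `V`.
  have hjump : ∃ᶠ l in atTop, x l ∈ U ∧ x (l + 1) ∈ V := by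
    intro hcon
    obtain ⟨N, hN⟩ := eventually_atTop.mp (hcon.and hev)
    obtain ⟨k, hkN, hk⟩ := frequently_atTop.mp hfU N
    have hstay : ∀ l, k ≤ l → x l ∈ U := fun l hl => by
      induction l, hl using Nat.le_induction with
      | base => exact hk
      | succ l hl ih =>
        exact ((hN (l + 1) (by omega)).2).resolve_right
          fun h => (hN l (by omega)).1 ⟨ih, h⟩
    obtain ⟨l, hl, hlV⟩ := frequently_atTop.mp hfV k
    exact Set.disjoint_left.mp hUV (hstay l hl) hlV
  -- Along the crossing times, `x l` and `x (l + 1)` share a limit, although one lies in `U` and the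
  -- other in `V`.
  obtain ⟨y, -, G, hG, hGF, hGy⟩ := hcl _ (frequently_mem_iff_neBot.mp hjump) inf_le_left
  have hGtop : G ≤ atTop := hGF.trans inf_le_left
  have hGj : ∀ᶠ l in G, x l ∈ U ∧ x (l + 1) ∈ V := hGF.trans inf_le_right (mem_principal_self _)
  rcases hcover y (hGy.mapClusterPt.mono hGtop) with hyU | hyV
  · have h := hstep G y hG hGtop hGy (hU.mem_nhds hyU)
    obtain ⟨l, hl1, hl2⟩ := (hGj.and h).exists
    exact Set.disjoint_left.mp hUV hl2 hl1.2
  · obtain ⟨l, hl1, hl2⟩ := (hGj.and (hGy (hV.mem_nhds hyV))).exists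
    exact Set.disjoint_left.mp hUV hl1.1 hl2

/-! ### Compactness of log-determinant sublevel sets -/

namespace Matrix

variable {m : Type*} [Fintype m]

/-- Testing the form on `e_i ± e_j` gives `2 |A i j| ≤ A i i + A j j`. -/
theorem PosSemidef.abs_apply_le_trace [DecidableEq m] {A : Matrix m m ℝ} (hA : A.PosSemidef) (i j : m) :
    |A i j| ≤ A.trace := by
  have hd : ∀ k, A k k ≤ A.trace := fun k =>
    Finset.single_le_sum (f := fun k => A k k) (fun k _ => hA.diag_nonneg) (Finset.mem_univ k)
  have hs : A j i = A i j := (isHermitian_iff_isSymm.mp hA.1).apply i j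
  have h1 := hA.dotProduct_nonneg (Pi.single i 1 + Pi.single j 1)
  have h2 := hA.dotProduct_nonneg (Pi.single i 1 - Pi.single j 1)
  simp only [mulVec_add, mulVec_sub, add_dotProduct, sub_dotProduct, dotProduct_add,
    dotProduct_sub, mulVec_single_one, single_one_dotProduct, col_apply, hs] at h1 h2
  have := hd i
  have := hd j
  rw [abs_le]
  constructor <;> linarith

theorem isClosed_setOf_posSemidef : IsClosed {A : Matrix m m ℝ | A.PosSemidef} := by
  have h : {A : Matrix m m ℝ | A.PosSemidef}
      = {A | Aᵀ = A} ∩ ⋂ x : m → ℝ, {A | 0 ≤ x ⬝ᵥ (A *ᵥ x)} := by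
    ext A
    simp only [Set.mem_ofPred_eq, Set.mem_inter_iff, Set.mem_iInter]
    refine ⟨fun hA => ⟨isHermitian_iff_isSymm.mp hA.1, hA.dotProduct_nonneg⟩, fun hA => ?_⟩
    exact PosSemidef.of_dotProduct_mulVec_nonneg (isHermitian_iff_isSymm.mpr hA.1)
      fun x => by simpa using hA.2 x
  rw [h]
  exact (isClosed_eq (by fun_prop) (by fun_prop)).inter
    (isClosed_iInter fun x => isClosed_le (by fun_prop) (by fun_prop))

variable [DecidableEq m]

theorem isCompact_setOf_posSemidef_trace_le (R : ℝ) :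
    IsCompact {A : Matrix m m ℝ | A.PosSemidef ∧ A.trace ≤ R} := by
  have hbox : IsCompact (Set.univ.pi fun _ : m => Set.univ.pi fun _ : m => Set.Icc (-R) R) :=
    isCompact_univ_pi fun _ => isCompact_univ_pi fun _ => isCompact_Icc
  have hclosed : IsClosed {A : Matrix m m ℝ | A.PosSemidef ∧ A.trace ≤ R} :=
    isClosed_setOf_posSemidef.inter (isClosed_le continuous_id.matrix_trace continuous_const)
  exact hbox.of_isClosed_subset hclosed fun A hA i _ j _ =>
    abs_le.mp ((hA.1.abs_apply_le_trace i j).trans hA.2)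

/-- The sublevel sets of `A ↦ tr (V A) - a log det A` are relatively compact in the set of
positive definite matrices. -/
theorem PosDef.exists_isCompact_trace_sub_log_det_le {V : Matrix m m ℝ} (hV : V.PosDef) {a : ℝ}
    (ha : 0 < a) (e : ℝ) :
    ∃ K : Set (Matrix m m ℝ), IsCompact K ∧ (∀ A ∈ K, A.PosDef) ∧
      ∀ A : Matrix m m ℝ, A.PosDef → (V * A).trace - a * Real.log A.det ≤ e → A ∈ K := by
  -- The scaling `(2 a)⁻¹` spends only half of `tr (V A)` on bounding `a log det A`; the other half
  -- gives the trace bound `R`.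
  have hB := hV.smul (show (0 : ℝ) < (2 * a)⁻¹ by positivity)
  obtain ⟨X, hX, hVX⟩ := hV.exists_transpose_mul_self
  have hXt : IsUnit Xᵀ.det := by rwa [det_transpose]
  set R : ℝ := 2 * (e - a * (Fintype.card m + Real.log ((2 * a)⁻¹ • V).det)) with hR
  -- As `tr (V A) ≥ 0`, the sublevel condition forces `det A ≥ exp (-e / a)`. This keeps limits
  -- nonsingular.
  set c : ℝ := V.det * Real.exp (-(e / a)) with hc
  have hc0 : 0 < c := mul_pos hV.det_pos (Real.exp_pos _)
  have hcpt : IsCompact ({A : Matrix m m ℝ | A.PosSemidef ∧ A.trace ≤ R} ∩ {A | c ≤ A.det}) :=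
    (isCompact_setOf_posSemidef_trace_le R).inter_right
      (isClosed_le (by fun_prop) (by fun_prop))
  refine ⟨(fun A => X⁻¹ * A * X⁻¹ᵀ) '' _, hcpt.image (by fun_prop), ?_, fun A hA hle => ?_⟩
  · rintro _ ⟨A, ⟨⟨hA, -⟩, hdet⟩, rfl⟩
    have hA' : A.PosDef := hA.posDef_iff_det_ne_zero.mpr (hc0.trans_le hdet).ne'
    exact hA'.mul_mul_transpose_of_isUnit (isUnit_nonsing_inv_det X hX)
  · have hK := hA.mul_mul_transpose_of_isUnit hX
    have htr : (X * A * Xᵀ).trace = (V * A).trace := by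
      rw [trace_mul_comm, ← Matrix.mul_assoc, ← hVX]
    have hdet : (X * A * Xᵀ).det = V.det * A.det := by
      rw [hVX]
      simp only [det_mul, det_transpose]
      ring
    refine ⟨X * A * Xᵀ, ⟨⟨hK.posSemidef, ?_⟩, ?_⟩, ?_⟩
    · have h := (PosDef.log_det_add_log_det_le hA hB).1
      rw [smul_mul, trace_smul, smul_eq_mul] at h
      have h2 := mul_le_mul_of_nonneg_left h ha.le
      have h3 : a * ((2 * a)⁻¹ * (V * A).trace - Fintype.card m)
          = (V * A).trace / 2 - a * Fintype.card m := by
        field_simp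
      rw [h3] at h2
      rw [htr, hR]
      linarith
    · have h0 : 0 ≤ (V * A).trace := htr ▸ hK.posSemidef.trace_nonneg
      rw [Set.mem_ofPred_eq, hdet, hc]
      refine mul_le_mul_of_nonneg_left ?_ hV.det_pos.le
      rw [← Real.le_log_iff_exp_le hA.det_pos, ← neg_div, div_le_iff₀ ha]
      linarith
    · change X⁻¹ * (X * A * Xᵀ) * X⁻¹ᵀ = A
      rw [transpose_nonsing_inv, Matrix.mul_assoc X, Matrix.nonsing_inv_mul_cancel_left _ _ hX,
        Matrix.mul_nonsing_inv_cancel_right _ _ hXt]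

theorem continuousAt_inv_of_isUnit_det {A : Matrix m m ℝ} (hA : IsUnit A.det) :
    ContinuousAt (fun B : Matrix m m ℝ => B⁻¹) A :=
  continuousAt_matrix_inv A (by
    rw [Ring.inverse_eq_inv']
    exact continuousAt_inv₀ hA.ne_zero)

end Matrix

/-! ### Continuity of one iteration -/

theorem ContinuousAt.matrix_mulVec {X m n : Type*} [TopologicalSpace X] [Fintype n]
    {A : X → Matrix m n ℝ} {v : X → n → ℝ} {x : X} (hA : ContinuousAt A x)
    (hv : ContinuousAt v x) : ContinuousAt (fun y => A y *ᵥ v y) x := by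
  have h : Continuous fun p : Matrix m n ℝ × (n → ℝ) => p.1 *ᵥ p.2 := by fun_prop
  exact h.continuousAt.comp (f := fun y => (A y, v y)) (hA.prodMk hv)

theorem ContinuousAt.matrix_inv {X m : Type*} [TopologicalSpace X] [Fintype m] [DecidableEq m]
    {A : X → Matrix m m ℝ} {x : X} (hA : ContinuousAt A x) (h : IsUnit (A x).det) :
    ContinuousAt (fun y => (A y)⁻¹) x :=
  (Matrix.continuousAt_inv_of_isUnit_det h).comp (f := A) hA

namespace HBE

variable {n M : ℕ} {P : Data n M} {L : Matrix (Fin n) (Fin n) ℝ}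

theorem continuousAt_gain (hSN : ∀ i, (P.SN i).PosDef) (hL : L.PosDef) (i : Fin M) :
    ContinuousAt (fun L => gain P L i) L := by
  have h := Matrix.continuousAt_inv_of_isUnit_det hL.isUnit_det
  exact (h.mul continuousAt_const).mul
    ((((continuousAt_const.mul h).mul continuousAt_const).add continuousAt_const).matrix_inv
      (obsCov_posDef hSN hL i).isUnit_det)

theorem continuousAt_updateMu (hSN : ∀ i, (P.SN i).PosDef) (hkappa : 0 < P.kappa)
    (hL : L.PosDef) : ContinuousAt (updateMu P) L := by
  have hg := continuousAt_gain hSN hL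
  refine ContinuousAt.matrix_mulVec (ContinuousAt.matrix_inv (continuousAt_const.add
    (tendsto_finsetSum _ fun i _ => (hg i).mul continuousAt_const)) ?_)
    ((tendsto_finsetSum _ fun i _ => (hg i).matrix_mulVec continuousAt_const).add
      continuousAt_const)
  exact isUnit_det_meanSystem hSN hkappa hL

theorem continuousAt_updateC (hSN : ∀ i, (P.SN i).PosDef) (hkappa : 0 < P.kappa)
    (hL : L.PosDef) : ContinuousAt (updateC P) L := by
  have hmu := continuousAt_updateMu hSN hkappa hL
  exact continuousAt_pi.mpr fun i => ((continuousAt_gain hSN hL i).matrix_mulVec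
    (continuousAt_const.sub (continuousAt_const.matrix_mulVec hmu))).add hmu

/-- One iteration of the algorithm, as a function of the precision matrix. -/
noncomputable def step (P : Data n M) (L : Matrix (Fin n) (Fin n) ℝ) : State n M :=
  (updateC P L, updateMu P L, updateL P (updateC P L) (updateMu P L))

theorem continuousAt_step (hM : 1 ≤ M) (hSN : ∀ i, (P.SN i).PosDef) (hS0 : P.S0.PosDef)
    (hkappa : 0 < P.kappa) (hnu : (n : ℝ) - 1 < P.nu) (hL : L.PosDef) :
    ContinuousAt (step P) L := by
  have hmu := continuousAt_updateMu hSN hkappa hL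
  have hC := continuousAt_updateC hSN hkappa hL
  refine hC.prodMk (hmu.prodMk ?_)
  have hs : Continuous fun p : (Fin M → Fin n → ℝ) × (Fin n → ℝ) =>
      (P.nu + M - n)⁻¹ • scatter P p.1 p.2 := by
    unfold scatter
    fun_prop
  refine ContinuousAt.matrix_inv (hs.continuousAt.comp
    (f := fun L => (updateC P L, updateMu P L)) (hC.prodMk hmu)) ?_
  exact ((scatter_posDef hS0 hnu hkappa _ _).smul (inv_pos.mpr (weight_pos hM hnu))).isUnit_det

end HBE

/-! ### Stationarity of partial optima -/

namespace Matrix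

variable {m : Type*} [Fintype m]

/-- Positivity of the form on the compact unit sphere persists for small `t`; homogeneity extends it
to all nonzero vectors. -/
theorem PosDef.eventually_add_smul {A H : Matrix m m ℝ} (hA : A.PosDef) (hH : H.IsHermitian) :
    ∀ᶠ t : ℝ in 𝓝 0, (A + t • H).PosDef := by
  have hs : ∀ᶠ t : ℝ in 𝓝 0, ∀ u ∈ Metric.sphere (0 : m → ℝ) 1, 0 < u ⬝ᵥ ((A + t • H) *ᵥ u) := by
    refine (isCompact_sphere _ _).eventually_forall_of_forall_eventually fun u hu => ?_
    have hc : Continuous fun z : ℝ × (m → ℝ) => z.2 ⬝ᵥ ((A + z.1 • H) *ᵥ z.2) := by fun_prop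
    refine hc.continuousAt.eventually (lt_mem_nhds ?_)
    simpa using hA.dotProduct_pos (Metric.ne_of_mem_sphere hu one_ne_zero)
  filter_upwards [hs] with t ht
  refine PosDef.of_dotProduct_mulVec_pos ?_ fun v hv => ?_
  · exact hA.1.add (isHermitian_iff_isSymm.mpr ((isHermitian_iff_isSymm.mp hH).smul t))
  · have hv' : 0 < ‖v‖ := norm_pos_iff.mpr hv
    have h := ht (‖v‖⁻¹ • v) (by simp [norm_smul, hv'.ne'])
    rw [mulVec_smul, smul_dotProduct, dotProduct_smul, smul_eq_mul, smul_eq_mul] at h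
    have h2 : 0 < ‖v‖⁻¹ := inv_pos.mpr hv'
    simpa using (mul_pos_iff_of_pos_left h2).mp ((mul_pos_iff_of_pos_left h2).mp h)

end Matrix

theorem HasFDerivAt.apply_eq_zero_of_eventually_le {E : Type*} [NormedAddCommGroup E]
    [NormedSpace ℝ E] {F : E → ℝ} {F' : E →L[ℝ] ℝ} {x v : E} (hF : HasFDerivAt F F' x)
    (h : ∀ᶠ t : ℝ in 𝓝 0, F x ≤ F (x + t • v)) : F' v = 0 := by
  refine IsLocalMin.hasDerivAt_eq_zero (f := fun t : ℝ => F (x + t • v)) (a := 0) ?_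
    (hF.hasLineDerivAt v)
  simpa [IsLocalMin, IsMinFilter] using h

namespace HBE

variable {n M : ℕ} {P : Data n M}

/-- The energy on the normed space of triples whose last component is a family of rows. -/
noncomputable def energyRows (P : Data n M)
    (x : (Fin M → Fin n → ℝ) × (Fin n → ℝ) × (Fin n → Fin n → ℝ)) : ℝ :=
  energy P x.1 x.2.1 (Matrix.of x.2.2)

theorem differentiableAt_energyRows (P : Data n M)
    (x : (Fin M → Fin n → ℝ) × (Fin n → ℝ) × (Fin n → Fin n → ℝ))
    (hx : (Matrix.of x.2.2).det ≠ 0) : DifferentiableAt ℝ (energyRows P) x := by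
  have hdet : Differentiable ℝ
      (fun x : (Fin M → Fin n → ℝ) × (Fin n → ℝ) × (Fin n → Fin n → ℝ) =>
        (Matrix.of x.2.2).det) := by
    simp only [det_apply, of_apply]
    fun_prop
  have hlog := (hdet x).log hx
  unfold energyRows energy
  simp only [dotProduct, mulVec, trace, diag, Matrix.mul_apply, of_apply, Pi.sub_apply]
  fun_prop

theorem continuousAt_f {x : State n M} (hx : x ∈ domain n M) : ContinuousAt (f P) x :=
  (differentiableAt_energyRows P x (Matrix.PosDef.det_pos hx).ne').continuousAt

theorem hasFDerivWithinAt_energyRows {C : Fin M → Fin n → ℝ} {mu : Fin n → ℝ}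
    {L : Fin n → Fin n → ℝ} (hL : (Matrix.of L).PosDef)
    (hmin1 : ∀ C' mu', energyRows P (C, mu, L) ≤ energyRows P (C', mu', L))
    (hmin2 : ∀ L', (Matrix.of L').PosDef → energyRows P (C, mu, L) ≤ energyRows P (C, mu, L')) :
    HasFDerivWithinAt (energyRows P)
      (0 : (Fin M → Fin n → ℝ) × (Fin n → ℝ) × (Fin n → Fin n → ℝ) →L[ℝ] ℝ)
      {y | (Matrix.of y.2.2).PosDef} (C, mu, L) := by
  obtain ⟨F', hF⟩ := differentiableAt_energyRows P (C, mu, L) hL.det_pos.ne'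
  have h1 : ∀ (h : Fin M → Fin n → ℝ) (k : Fin n → ℝ), F' (h, k, 0) = 0 := fun h k =>
    hF.apply_eq_zero_of_eventually_le <| Eventually.of_forall fun t => by
      rw [Prod.smul_mk, Prod.smul_mk, Prod.mk_add_mk, Prod.mk_add_mk, smul_zero, add_zero]
      exact hmin1 _ _
  have h2 : ∀ H : Fin n → Fin n → ℝ, (Matrix.of H).IsHermitian → F' (0, 0, H) = 0 :=
    fun H hH => by
      refine hF.apply_eq_zero_of_eventually_le ?_
      filter_upwards [hL.eventually_add_smul hH] with t ht
      rw [Prod.smul_mk, Prod.smul_mk, Prod.mk_add_mk, Prod.mk_add_mk, smul_zero, smul_zero,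
        add_zero, add_zero]
      exact hmin2 _ ht
  -- Differences of points of the domain have a symmetric last component, so `F'` is not needed in
  -- other directions.
  have hF0 : ∀ y : (Fin M → Fin n → ℝ) × (Fin n → ℝ) × (Fin n → Fin n → ℝ),
      (Matrix.of y.2.2).PosDef → F' (y - (C, mu, L)) = 0 := fun y hy => by
    have : y - (C, mu, L) = (y.1 - C, y.2.1 - mu, 0) + (0, 0, y.2.2 - L) := by
      ext <;> simp
    rw [this, map_add, h1, h2 (y.2.2 - L) (hy.1.sub hL.1), add_zero]
  have hF2 := hF.hasFDerivWithinAt (s := {y | (Matrix.of y.2.2).PosDef})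
  rw [hasFDerivWithinAt_iff_isLittleOTVS] at hF2 ⊢
  refine hF2.congr' ?_ EventuallyEq.rfl
  filter_upwards [self_mem_nhdsWithin] with y hy
  rw [hF0 y hy, _root_.zero_apply]

theorem hasFDerivWithinAt_f {C : Fin M → Fin n → ℝ} {mu : Fin n → ℝ}
    {L : Matrix (Fin n) (Fin n) ℝ} (hL : L.PosDef)
    (hmin1 : ∀ C' mu', energy P C mu L ≤ energy P C' mu' L)
    (hmin2 : ∀ L' : Matrix (Fin n) (Fin n) ℝ, L'.PosDef → energy P C mu L ≤ energy P C mu L') :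
    HasFDerivWithinAt (f P) (0 : State n M →L[ℝ] ℝ) (domain n M) (C, mu, L) :=
  hasFDerivWithinAt_energyRows (L := Matrix.of.symm L) hL hmin1 hmin2

theorem IsPartialOptimum.isStationary {x : State n M} (hx : IsPartialOptimum P x) :
    IsStationary P x := by
  obtain ⟨C, mu, L⟩ := x
  obtain ⟨hdom, hmin1, hmin2⟩ := hx
  exact ⟨hdom, hasFDerivWithinAt_f hdom
    (fun C' mu' => isMinOn_iff.mp hmin1 (C', mu') (Set.mem_univ _))
    fun L' hL' => isMinOn_iff.mp hmin2 L' hL'⟩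

end HBE

/-! ### Descent, fixed points and confinement of the iterates -/

namespace HBE

theorem IsArgmin.le {α : Type*} {g : α → ℝ} {s : Set α} {a b : α} (h : IsArgmin g s a)
    (hb : b ∈ s) : g a ≤ g b := by
  by_cases hab : b = a
  · rw [hab]
  · exact (h.2 b hb hab).le

theorem IsArgmin.eq_of_le {α : Type*} {g : α → ℝ} {s : Set α} {a b : α} (h : IsArgmin g s a)
    (hb : b ∈ s) (hle : g b ≤ g a) : b = a :=
  by_contra fun hab => absurd (h.2 b hb hab) (not_lt.mpr hle)

variable {n M : ℕ} {P : Data n M} {L : Matrix (Fin n) (Fin n) ℝ}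

section

variable (hM : 1 ≤ M) (hSN : ∀ i, (P.SN i).PosDef) (hS0 : P.S0.PosDef) (hkappa : 0 < P.kappa)
  (hnu : (n : ℝ) - 1 < P.nu)

include hSN hkappa in
-- Dropping the nonnegative quadratic terms leaves a bound that controls `L` independently of `(C,
-- μ)`.
theorem trace_sub_log_det_le_energy (C : Fin M → Fin n → ℝ) (mu : Fin n → ℝ) (hL : L.PosDef) :
    (P.nu • P.S0 * L).trace - (P.nu + M - n) * Real.log L.det ≤ 2 * energy P C mu L := by
  have h1 : 0 ≤ ∑ i, (P.Z i - P.D i *ᵥ C i) ⬝ᵥ ((P.SN i)⁻¹ *ᵥ (P.Z i - P.D i *ᵥ C i)) :=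
    Finset.sum_nonneg fun i _ => (hSN i).inv.posSemidef.dotProduct_nonneg _
  have h2 : 0 ≤ ∑ i, (C i - mu) ⬝ᵥ (L *ᵥ (C i - mu)) :=
    Finset.sum_nonneg fun i _ => hL.posSemidef.dotProduct_nonneg _
  have h3 := mul_nonneg hkappa.le (hL.posSemidef.dotProduct_nonneg (mu - P.mu0))
  unfold energy
  linarith

include hM hSN hS0 hkappa hnu in
theorem exists_le_energy : ∃ c : ℝ, ∀ (C : Fin M → Fin n → ℝ) (mu : Fin n → ℝ)
    (L : Matrix (Fin n) (Fin n) ℝ), L.PosDef → c ≤ energy P C mu L := by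
  have ha := weight_pos hM hnu
  have hB := (smul_S0_posDef hS0 hnu).smul (inv_pos.mpr ha)
  refine ⟨(P.nu + M - n) * (n + Real.log ((P.nu + M - n)⁻¹ • P.nu • P.S0).det) / 2,
    fun C mu L hL => ?_⟩
  have h1 := trace_sub_log_det_le_energy hSN hkappa C mu hL
  have h2 := mul_le_mul_of_nonneg_left (PosDef.log_det_add_log_det_le hL hB).1 ha.le
  rw [smul_mul, trace_smul, smul_eq_mul, mul_sub, mul_inv_cancel_left₀ ha.ne',
    Fintype.card_fin] at h2
  linarith

include hM hSN hS0 hkappa hnu in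
theorem f_step_le {x : State n M} (hx : x ∈ domain n M) : f P (step P x.2.2) ≤ f P x := by
  have h1 := (isArgmin_update hSN hkappa hx).le (Set.mem_univ (x.1, x.2.1))
  have h2 := (isArgmin_updateL hM hS0 hnu hkappa (updateC P x.2.2) (updateMu P x.2.2)).le hx
  exact h2.trans h1

include hM hSN hS0 hkappa hnu in
-- Neither half-step can lower the energy, so by uniqueness of the minimizers neither one moves the
-- point.
theorem step_eq_of_f_le {x : State n M} (hx : x ∈ domain n M) (hle : f P x ≤ f P (step P x.2.2)) :
    step P x.2.2 = x := by
  have h1 := isArgmin_update hSN hkappa hx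
  have h2 := isArgmin_updateL hM hS0 hnu hkappa (updateC P x.2.2) (updateMu P x.2.2)
  have e1 : (x.1, x.2.1) = (updateC P x.2.2, updateMu P x.2.2) :=
    h1.eq_of_le (Set.mem_univ _) (hle.trans (h2.le hx))
  have e2 : x.2.2 = updateL P (updateC P x.2.2) (updateMu P x.2.2) :=
    h2.eq_of_le hx ((h1.le (Set.mem_univ (x.1, x.2.1))).trans hle)
  rw [Prod.mk.injEq] at e1
  exact Prod.ext e1.1.symm (Prod.ext e1.2.symm e2.symm)

include hM hSN hS0 hkappa hnu in
theorem isPartialOptimum_of_step_eq {x : State n M} (hx : x ∈ domain n M)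
    (h : step P x.2.2 = x) : IsPartialOptimum P x := by
  have hC : updateC P x.2.2 = x.1 := congrArg Prod.fst h
  have hmu : updateMu P x.2.2 = x.2.1 := congrArg (fun y => y.2.1) h
  have hL : updateL P (updateC P x.2.2) (updateMu P x.2.2) = x.2.2 := congrArg (fun y => y.2.2) h
  have h1 := isArgmin_update hSN hkappa hx
  have h2 := isArgmin_updateL hM hS0 hnu hkappa x.1 x.2.1
  rw [hC, hmu] at h1 hL
  rw [hL] at h2
  exact ⟨hx, fun p hp => h1.le hp, fun L hL => h2.le hL⟩

variable {L0 : Matrix (Fin n) (Fin n) ℝ} (hL0 : L0.PosDef)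

include hM hS0 hkappa hnu hL0 in
theorem precision_posDef : ∀ l, (precision P L0 l).PosDef
  | 0 => hL0
  | _ + 1 => updateL_posDef hM hS0 hnu hkappa _ _

include hM hSN hS0 hkappa hnu hL0 in
theorem antitone_f_iter : Antitone fun l => f P (iter P L0 l) :=
  antitone_nat_of_succ_le fun l => f_step_le hM hSN hS0 hkappa hnu (x := iter P L0 l)
    (precision_posDef hM hS0 hkappa hnu hL0 (l + 1))

include hM hSN hS0 hkappa hnu hL0 in
theorem exists_isCompact_iter_mem : ∃ K : Set (State n M), IsCompact K ∧ K ⊆ domain n M ∧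
    ∀ᶠ l in atTop, iter P L0 l ∈ K := by
  obtain ⟨K, hK, hKpd, hKmem⟩ := (smul_S0_posDef hS0 hnu).exists_isCompact_trace_sub_log_det_le
    (weight_pos hM hnu) (2 * f P (iter P L0 0))
  -- No coercivity in `(C, μ)` is needed, as iterates are values of `step`. The start `L0` may lie
  -- outside `K`, hence `l ≥ 1`.
  refine ⟨step P '' K, ?_, ?_, eventually_atTop.mpr ⟨1, fun l hl => ?_⟩⟩
  · exact hK.image_of_continuousOn fun L hL =>
      (continuousAt_step hM hSN hS0 hkappa hnu (hKpd L hL)).continuousWithinAt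
  · rintro _ ⟨L, -, rfl⟩
    exact updateL_posDef hM hS0 hnu hkappa _ _
  · obtain ⟨k, rfl⟩ := Nat.exists_eq_add_of_le' hl
    have hpd := precision_posDef hM hS0 hkappa hnu hL0 (k + 1)
    refine ⟨precision P L0 (k + 1), hKmem _ hpd ?_, rfl⟩
    refine (trace_sub_log_det_le_energy hSN hkappa (iter P L0 k).1 (iter P L0 k).2.1 hpd).trans ?_
    exact mul_le_mul_of_nonneg_left
      (antitone_f_iter hM hSN hS0 hkappa hnu hL0 (Nat.zero_le k)) zero_le_two

end

end HBE

/-! ### Convergence of the algorithm -/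

theorem proposition3 (n M : ℕ) (hM : 1 ≤ M) (P : HBE.Data n M)
    (hSN : ∀ i, (P.SN i).PosDef) (hS0 : P.S0.PosDef)
    (hkappa : 0 < P.kappa) (hnu : (n : ℝ) - 1 < P.nu)
    (L0 : Matrix (Fin n) (Fin n) ℝ) (hL0 : L0.PosDef) :
    -- the iterates carry out alternating minimization
    (∀ l : ℕ,
      HBE.IsArgmin
        (fun p : (Fin M → Fin n → ℝ) × (Fin n → ℝ) =>
          HBE.energy P p.1 p.2 (HBE.precision P L0 l))
        Set.univ ((HBE.iter P L0 l).1, (HBE.iter P L0 l).2.1) ∧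
      HBE.IsArgmin
        (fun L => HBE.energy P (HBE.iter P L0 l).1 (HBE.iter P L0 l).2.1 L)
        (HBE.posDefSet n) (HBE.iter P L0 l).2.2) ∧
    -- the energy decreases along the iterates and converges
    Antitone (fun l => HBE.f P (HBE.iter P L0 l)) ∧
    (∃ v : ℝ, Tendsto (fun l => HBE.f P (HBE.iter P L0 l)) atTop (𝓝 v) ∧
      ∀ x ∈ HBE.accPoints (HBE.iter P L0), HBE.f P x = v) ∧
    -- the accumulation points
    (HBE.accPoints (HBE.iter P L0)).Nonempty ∧
    IsCompact (HBE.accPoints (HBE.iter P L0)) ∧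
    IsConnected (HBE.accPoints (HBE.iter P L0)) ∧
    (∀ x ∈ HBE.accPoints (HBE.iter P L0),
      HBE.IsPartialOptimum P x ∧ HBE.IsStationary P x) := by
  have hpd := HBE.precision_posDef hM hS0 hkappa hnu hL0
  have hanti := HBE.antitone_f_iter hM hSN hS0 hkappa hnu hL0
  obtain ⟨c, hc⟩ := HBE.exists_le_energy hM hSN hS0 hkappa hnu
  obtain ⟨K, hK, hKdom, hKmem⟩ := HBE.exists_isCompact_iter_mem hM hSN hS0 hkappa hnu hL0
  obtain ⟨v, hv⟩ : ∃ v : ℝ, Tendsto (fun l => HBE.f P (HBE.iter P L0 l)) atTop (𝓝 v) :=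
    ⟨_, tendsto_atTop_ciInf hanti ⟨c, by
      rintro _ ⟨l, rfl⟩
      exact hc _ _ _ (hpd (l + 1))⟩⟩
  have hclosed : IsClosed (HBE.accPoints (HBE.iter P L0)) := isClosed_setOfPred_clusterPt
  have hsub : HBE.accPoints (HBE.iter P L0) ⊆ K := fun y hy =>
    isClosed_iff_clusterPt.mp hK.isClosed y
      ((show MapClusterPt y atTop _ from hy).clusterPt.mono (le_principal_iff.mpr hKmem))
  have hval : ∀ x ∈ HBE.accPoints (HBE.iter P L0), HBE.f P x = v := fun x hx =>
    eq_of_nhds_neBot <| ((show MapClusterPt x atTop _ from hx).continuousAt_comp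
      (HBE.continuousAt_f (hKdom (hsub hx)))).clusterPt.mono hv
  have hstepc : ∀ x ∈ HBE.accPoints (HBE.iter P L0),
      ContinuousAt (fun y : HBE.State n M => HBE.step P y.2.2) x := fun x hx =>
    ContinuousAt.comp (g := HBE.step P) (f := fun y : HBE.State n M => y.2.2)
      (HBE.continuousAt_step hM hSN hS0 hkappa hnu (hKdom (hsub hx)))
      (by fun_prop)
  have hfix : ∀ x ∈ HBE.accPoints (HBE.iter P L0), HBE.step P x.2.2 = x := fun x hx => by
    -- By continuity, `step` maps cluster points of the iterates to cluster points of the shifted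
    -- sequence.
    have hstep : HBE.step P x.2.2 ∈ HBE.accPoints (HBE.iter P L0) := by
      have h := (show MapClusterPt x atTop _ from hx).continuousAt_comp (hstepc x hx)
      exact MapClusterPt.of_comp (φ := fun l => l + 1) (tendsto_add_atTop_nat 1) h
    exact HBE.step_eq_of_f_le hM hSN hS0 hkappa hnu (hKdom (hsub hx))
      ((hval x hx).trans (hval _ hstep).symm).le
  have hne : (HBE.accPoints (HBE.iter P L0)).Nonempty := by
    obtain ⟨y, -, hy⟩ := hK.exists_mapClusterPt (le_principal_iff.mpr hKmem)
    exact ⟨y, hy⟩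
  have hopt : ∀ x ∈ HBE.accPoints (HBE.iter P L0), HBE.IsPartialOptimum P x := fun x hx =>
    HBE.isPartialOptimum_of_step_eq hM hSN hS0 hkappa hnu (hKdom (hsub hx)) (hfix x hx)
  refine ⟨fun l => ⟨HBE.isArgmin_update hSN hkappa (hpd l),
      HBE.isArgmin_updateL hM hS0 hnu hkappa _ _⟩, hanti, ⟨v, hv, hval⟩, hne,
    hK.of_isClosed_subset hclosed hsub, ⟨hne, ?_⟩, fun x hx => ⟨hopt x hx, (hopt x hx).isStationary⟩⟩
  -- The successors converge to the image of `y` under `step`, which is `y` because accumulation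
  -- points are fixed.
  refine isPreconnected_setOf_mapClusterPt hK hKmem fun F y _ hF hy => ?_
  have hyacc : y ∈ HBE.accPoints (HBE.iter P L0) := hy.mapClusterPt.mono hF
  have h := (hstepc y hyacc).tendsto.comp hy
  rw [hfix y hyacc] at h
  exact h
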